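/- Let $k\ge 1$, $\lambda\ge 1$ and $0\le s\le k$ be integers with $s$ even. For a real vector $x$ indexed by $\{-1,1\}^k$ and $u\subseteq[k]=\{1,\dots,k\}$ define the interactions $x_u$ recursively by $$x_u(i_1,\dots,i_k)=2^{|u|-k}\sum_{i':\ i'_j=i_j\ \forall j\in u}x(i'_1,\dots,i'_k)-\sum_{v\subsetneq u}x_v(i_1,\dots,i_k),$$ and the $J$-characteristics $J^x_u=2^k x_u$. Consider the integer linear description (ILD) $$J^x_\emptyset=\lambda 2^s,\qquad J^x_u=0\ \ (1\le|u|\le s),\qquad 0\le x(i)\le p_{\max},\quad x(i)\in\mathbb Z\qquad(i\in\{-1,1\}^k),$$ where $p_{\max}$ is any integer; its first two families are the equality constraints of the ILD (its feasible points are the frequency vectors of the two-symbol orthogonal arrays of strength $s$, index $\lambda$ with $k$ columns, when $p_{\max}$ is large enough). Let $G(k)^{\rm OD}$ be the group of permutations of $\{-1,1\}^k$ generated by the permutations of the $k$ coordinates, the sign changes of single coordinates, and the maps $R_j$ ($1\le j\le k$), where $R_j$ multiplies every coordinate other than the $j$-th by the $j$-th coordinate; it acts on vectors indexed by $\{-1,1\}^k$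 by permuting entries. Let $$\Omega=\Big\{d\in\mathbb Z\ :\ 0\le d\le k-s-1,\ d\text{ even},\ \lambda\tbinom{s+d}{d}\equiv0\pmod 2\Big\}.$$ Let $x$ be a feasible point of the ILD. Then there is a set $T\subseteq\Omega$ such that: (i) the dimension of the convex hull of the orbit $G(k)^{\rm OD}x$ is $$2^k-\sum_{j=0}^{s}\binom kj-\sum_{d\in T}\left(\binom{k}{s+d+1}+\binom{k}{s+d+2}\right),$$ where $\binom km=0$ if $m>k$; (ii) the affine hull of the convex hull of the orbit equals the affine hull of the orbit, and it is the set of all real vectors $z$ indexed by $\{-1,1\}^k$ that satisfy the equality constraints of the ILD together with $$J^z_{u''}(i)=0\quad\text{for all } i\in\{-1,1\}^k,\ d\in T \text{ and } u''\subseteq[k]\text{ with } s+d+1\le|u''|\le s+d+2.$$ -/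

import Mathlib

open Finset

/-! ### ANOVA decomposition and J-characteristics -/

section JCharacteristics

variable {k : ℕ} {α : Type*} [Fintype α] [DecidableEq α]

/-- The interaction `x_u` of the ANOVA decomposition of a vector `x` indexed by the `n ^ k` symbol
combinations `(i₁, …, i_k)`, where `n` is the number of symbols:
`x_u(i) = n ^ (|u| - k) * ∑ x(i') - ∑_{v ⊊ u} x_v(i)`, the first sum being over all `i'` which
agree with `i` on the columns in `u`. For `u = ∅` this is the grand mean. -/
noncomputable def anova (x : (Fin k → α) → ℝ) (u : Finset (Fin k)) (i : Fin k → α) : ℝ :=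
  (Fintype.card α : ℝ) ^ ((#u : ℤ) - (k : ℤ)) * ∑ i' with ∀ j ∈ u, i' j = i j, x i' -
    ∑ v ∈ u.ssubsets.attach, anova x v.1 i
termination_by #u
decreasing_by exact Finset.card_lt_card (Finset.mem_ssubsets.1 v.2)

/-- The defining recursion of the interactions. -/
theorem anova_eq (x : (Fin k → α) → ℝ) (u : Finset (Fin k)) (i : Fin k → α) :
    anova x u i =
      (Fintype.card α : ℝ) ^ ((#u : ℤ) - (k : ℤ)) * ∑ i' with ∀ j ∈ u, i' j = i j, x i' -
        ∑ v ∈ u.ssubsets, anova x v i := by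
  rw [anova, Finset.sum_attach u.ssubsets (fun v => anova x v i)]

/-- The J-characteristic `J_u^x(i₁, …, i_k) = n ^ k * x_u(i₁, …, i_k)`. -/
noncomputable def jChar (x : (Fin k → α) → ℝ) (u : Finset (Fin k)) (i : Fin k → α) : ℝ :=
  (Fintype.card α : ℝ) ^ k * anova x u i

/-- The equality constraints of the integer linear description (ILD) of the frequency vectors of
orthogonal arrays `OA(lam * n ^ s, k, n, s)`. -/
def ILDEqualities (s lam : ℕ) (x : (Fin k → α) → ℝ) : Prop :=
  (∀ i, jChar x ∅ i = (lam : ℝ) * (Fintype.card α : ℝ) ^ s) ∧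
  ∀ u : Finset (Fin k), 1 ≤ #u → #u ≤ s → ∀ i, jChar x u i = 0

/-- Feasible points of the ILD: the equality constraints, `0 ≤ x(i) ≤ pmax`, and integrality. -/
def ILDFeasible (s lam : ℕ) (pmax : ℤ) (x : (Fin k → α) → ℝ) : Prop :=
  ILDEqualities s lam x ∧ ∀ i, 0 ≤ x i ∧ x i ≤ (pmax : ℝ) ∧ ∃ m : ℤ, x i = (m : ℝ)

end JCharacteristics

/-! ### The groups -/

/-- The paratopism group, as a group of permutations of the symbol combinations: its elements
`((h₁, …, h_k), g)` send `(i₁, …, i_k)` to `(h₁(i_{g⁻¹(1)}), …, h_k(i_{g⁻¹(k)}))`. -/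
def Giso (k : ℕ) (α : Type*) : Subgroup (Equiv.Perm (Fin k → α)) where
  carrier := {σ | ∃ (h : Fin k → Equiv.Perm α) (g : Equiv.Perm (Fin k)),
    ∀ (i : Fin k → α) (j : Fin k), σ i j = h j (i (g⁻¹ j))}
  one_mem' := ⟨fun _ => 1, 1, fun i j => by simp⟩
  mul_mem' := by
    rintro σ τ ⟨h, g, hσ⟩ ⟨h', g', hτ⟩
    refine ⟨fun j => h j * h' (g⁻¹ j), g * g', fun i j => ?_⟩
    simp [Equiv.Perm.mul_apply, hσ, hτ, mul_inv_rev]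
  inv_mem' := by
    rintro σ ⟨h, g, hσ⟩
    refine ⟨fun j => (h (g j))⁻¹, g⁻¹, fun i j => ?_⟩
    have e := hσ (σ⁻¹ i) (g j)
    simp only [← Equiv.Perm.mul_apply, mul_inv_cancel, inv_mul_cancel, Equiv.Perm.one_apply] at e
    simp [e]

/-- The column operation `R_j` on the rows of the array of all `2 ^ k` combinations of the symbols
`-1, 1` (the elements of `ℤˣ`): multiply every column other than column `j` by column `j`. -/
def colOp {k : ℕ} (j : Fin k) : Equiv.Perm (Fin k → ℤˣ) :=
  Function.Involutive.toPerm (fun z i => if i = j then z j else z i * z j) (by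
    intro z
    funext i
    by_cases h : i = j
    · simp [h]
    · simp [h, mul_assoc])

/-- The group `G(k)^OD` generated by `R₁, …, R_k` and the paratopism group. -/
def GOD (k : ℕ) : Subgroup (Equiv.Perm (Fin k → ℤˣ)) :=
  Subgroup.closure (Set.range (colOp (k := k)) ∪ (Giso k ℤˣ : Set (Equiv.Perm (Fin k → ℤˣ))))

/-- The orbit `G x` of a vector `x`, where a permutation `g` of the index set permutes the entries
of `x`. -/
def vecOrbit {ι : Type*} (G : Subgroup (Equiv.Perm ι)) (x : ι → ℝ) : Set (ι → ℝ) :=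
  {v | ∃ g ∈ G, v = fun i => x (g⁻¹ i)}

/-! ### Dimension and the set `Ω` -/

/-- Dimension of a set of points: the dimension of its affine hull. -/
noncomputable def setDim {V : Type*} [AddCommGroup V] [Module ℝ V] (S : Set V) : ℕ :=
  Module.finrank ℝ (affineSpan ℝ S).direction

/-- `Ω`: the even integers `d` in `[0, k - s - 1]` with `lam * C(s + d, d)` even. -/
def Omega (k s lam : ℕ) : Finset ℕ :=
  {d ∈ range (k - s) | Even d ∧ lam * (s + d).choose d ≡ 0 [MOD 2]}

/-! The proof is Fourier analysis on the group {-1,1}^k. By `jChar_eq`, each J-characteristic is a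
character times one Walsh coefficient, so every constraint prescribes Walsh coefficients.

The group permutes the characters up to sign. R_j removes j from a set of even size and adds j to
one of odd size, while coordinate permutations mix sets of equal size. Hence its orbits on nonempty
u are the classes of sizes {2m-1, 2m} (`carriesWalsh_of_mem_GOD`, `exists_carriesWalsh`).

Sign changes translate the index group, so summing translates against a character isolates that
character. Therefore the direction of the affine hull is spanned by the classes on which x has some
nonzero coefficient (`vectorSpan_vecOrbit`). As s is even, the sizes 1, ..., s fill whole vanishing
classes; T records the other vanishing classes {s+d+1, s+d+2}.

Integrality forces T into Ω: a coefficient at size s+d+1 is congruent to λ 2^s C(s+d,s) modulo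
2^(s+1) (`sum_walsh_modEq`), so it can vanish only if λ C(s+d,d) is even. -/

/-! ### Walsh characters -/

section Walsh

variable {k : ℕ}

/-- The character `i ↦ ∏ j ∈ u, i j` of the group `{-1, 1} ^ k`. -/
def walsh (u : Finset (Fin k)) (i : Fin k → ℤˣ) : ℤˣ := ∏ j ∈ u, i j

/-- The character `walsh u` as a real vector. -/
def walshVec (u : Finset (Fin k)) (i : Fin k → ℤˣ) : ℝ := ((walsh u i : ℤ) : ℝ)

/-- The unnormalised Walsh–Fourier coefficient of `x` at `u`. -/
noncomputable def walshCoeff (x : (Fin k → ℤˣ) → ℝ) (u : Finset (Fin k)) : ℝ :=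
  ∑ i, walshVec u i * x i

theorem walsh_mul (u : Finset (Fin k)) (i i' : Fin k → ℤˣ) :
    walsh u (i * i') = walsh u i * walsh u i' := by
  simp [walsh, Finset.prod_mul_distrib]

theorem walshVec_mul (u : Finset (Fin k)) (i i' : Fin k → ℤˣ) :
    walshVec u (i * i') = walshVec u i * walshVec u i' := by
  simp [walshVec, walsh_mul]

theorem walshVec_mul_self (u : Finset (Fin k)) (i : Fin k → ℤˣ) :
    walshVec u i * walshVec u i = 1 := by
  rcases Int.units_eq_one_or (walsh u i) with h | h <;> simp [walshVec, h]

theorem walshVec_ne_zero (u : Finset (Fin k)) (i : Fin k → ℤˣ) : walshVec u i ≠ 0 :=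
  left_ne_zero_of_mul_eq_one (walshVec_mul_self u i)

theorem walshVec_eq_prod (u : Finset (Fin k)) (i : Fin k → ℤˣ) :
    walshVec u i = ∏ j ∈ u, ((i j : ℤ) : ℝ) := by
  simp [walshVec, walsh, Units.coe_prod]

/-- The sum factors as the product over j in u of 1 + i_j i'_j, and each factor is 2 or 0. -/
theorem sum_powerset_walshVec (u : Finset (Fin k)) (i i' : Fin k → ℤˣ) :
    ∑ v ∈ u.powerset, walshVec v i * walshVec v i' =
      if ∀ j ∈ u, i' j = i j then (2 : ℝ) ^ #u else 0 := by
  have h : ∀ v, walshVec v i * walshVec v i' = ∏ j ∈ v, (((i j * i' j : ℤˣ) : ℤ) : ℝ) := by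
    intro v
    rw [← walshVec_mul, walshVec_eq_prod]
    rfl
  simp_rw [h, ← Finset.prod_one_add]
  split_ifs with hu
  · rw [Finset.prod_congr rfl (g := fun _ => (2 : ℝ)), Finset.prod_const]
    intro j hj
    rw [hu j hj, Int.units_mul_self]
    norm_num
  · push Not at hu
    obtain ⟨j, hj, hne⟩ := hu
    refine Finset.prod_eq_zero hj ?_
    rcases Int.units_eq_one_or (i j) with h1 | h1 <;>
      rcases Int.units_eq_one_or (i' j) with h2 | h2 <;> simp_all

theorem sum_agree_eq (x : (Fin k → ℤˣ) → ℝ) (u : Finset (Fin k)) (i : Fin k → ℤˣ) :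
    (2 : ℝ) ^ #u * ∑ i' with ∀ j ∈ u, i' j = i j, x i' =
      ∑ v ∈ u.powerset, walshVec v i * walshCoeff x v := by
  simp_rw [walshCoeff, Finset.mul_sum]
  rw [Finset.sum_comm, Finset.sum_filter]
  refine Finset.sum_congr rfl fun i' _ => ?_
  simp_rw [← mul_assoc]
  rw [← Finset.sum_mul, sum_powerset_walshVec]
  split_ifs <;> simp

/-- By `sum_agree_eq` the scaled marginal is the sum of these products over all subsets of u; the
recursion subtracts the proper ones, leaving the term of u. -/
theorem jChar_eq (x : (Fin k → ℤˣ) → ℝ) (u : Finset (Fin k)) (i : Fin k → ℤˣ) :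
    jChar x u i = walshVec u i * walshCoeff x u := by
  induction u using Finset.strongInduction with
  | H u ih =>
    have hpow : (2 : ℝ) ^ k * (2 : ℝ) ^ ((#u : ℤ) - (k : ℤ)) = 2 ^ #u := by
      rw [← zpow_natCast, ← zpow_add₀ two_ne_zero, add_sub_cancel, zpow_natCast]
    have h : jChar x u i = 2 ^ #u * ∑ i' with ∀ j ∈ u, i' j = i j, x i' -
        ∑ v ∈ u.ssubsets, jChar x v i := by
      simp only [jChar]
      rw [anova_eq, mul_sub, ← mul_assoc, Fintype.card_units_int, Nat.cast_ofNat, hpow,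
        Finset.mul_sum _ _ ((2 : ℝ) ^ k)]
    rw [h, sum_agree_eq, Finset.sum_congr rfl fun v hv => ih v (Finset.mem_ssubsets.1 hv),
      Finset.ssubsets, ← Finset.add_sum_erase _ _ (Finset.mem_powerset_self u)]
    ring

theorem forall_jChar_eq_zero_iff (x : (Fin k → ℤˣ) → ℝ) (u : Finset (Fin k)) :
    (∀ i, jChar x u i = 0) ↔ walshCoeff x u = 0 := by
  refine ⟨fun h => ?_, fun h i => by rw [jChar_eq, h, mul_zero]⟩
  have := h 1
  rw [jChar_eq] at this
  exact (mul_eq_zero.1 this).resolve_left (walshVec_ne_zero u 1)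

theorem ildEqualities_iff (s lam : ℕ) (x : (Fin k → ℤˣ) → ℝ) :
    ILDEqualities s lam x ↔ walshCoeff x ∅ = lam * 2 ^ s ∧
      ∀ u : Finset (Fin k), 1 ≤ #u → #u ≤ s → walshCoeff x u = 0 := by
  simp only [ILDEqualities, forall_jChar_eq_zero_iff]
  simp [jChar_eq, walshVec, walsh]

theorem walshCoeff_sub (x y : (Fin k → ℤˣ) → ℝ) (u : Finset (Fin k)) :
    walshCoeff (x - y) u = walshCoeff x u - walshCoeff y u := by
  simp [walshCoeff, mul_sub]

/-- The Walsh–Fourier coefficient as a linear functional. -/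
noncomputable def walshCoeffₗ (u : Finset (Fin k)) : ((Fin k → ℤˣ) → ℝ) →ₗ[ℝ] ℝ where
  toFun x := walshCoeff x u
  map_add' x y := by simp [walshCoeff, mul_add, Finset.sum_add_distrib]
  map_smul' c x := by
    simp only [walshCoeff, Finset.mul_sum, Pi.smul_apply, smul_eq_mul, RingHom.id_apply]
    exact Finset.sum_congr rfl fun i _ => by ring

/-- Fourier inversion. -/
theorem sum_walshCoeff_smul (x : (Fin k → ℤˣ) → ℝ) :
    ∑ u, walshCoeff x u • walshVec u = (2 : ℝ) ^ k • x := by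
  funext i
  have h := sum_agree_eq x Finset.univ i
  have hf : (Finset.univ.filter fun i' : Fin k → ℤˣ => ∀ j ∈ (Finset.univ : Finset (Fin k)),
      i' j = i j) = {i} := by
    ext i'
    simp [funext_iff]
  rw [hf, Finset.sum_singleton, Finset.card_univ, Fintype.card_fin, Finset.powerset_univ] at h
  simp only [Finset.sum_apply, Pi.smul_apply, smul_eq_mul]
  rw [h]
  exact Finset.sum_congr rfl fun u _ => mul_comm _ _

theorem sum_walshVec_eq_zero {u : Finset (Fin k)} (hu : u.Nonempty) :
    ∑ i, walshVec u i = 0 := by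
  -- Translation by such an `a` preserves the sum and also negates it.
  obtain ⟨a, ha⟩ : ∃ a, walshVec u a = -1 := by
    obtain ⟨j, hj⟩ := hu
    refine ⟨fun l => if l = j then -1 else 1, ?_⟩
    rw [walshVec, walsh, Finset.prod_ite_eq_of_mem' u j (fun _ => -1) hj]
    simp
  have h : ∑ i, walshVec u (a * i) = ∑ i, walshVec u i :=
    Equiv.sum_comp (Equiv.mulLeft a) (walshVec u)
  simp_rw [walshVec_mul, ha] at h
  rw [← Finset.mul_sum, neg_one_mul] at h
  exact neg_eq_self.1 h

theorem walshVec_mul_walshVec (u v : Finset (Fin k)) (i : Fin k → ℤˣ) :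
    walshVec u i * walshVec v i = walshVec (symmDiff u v) i := by
  have h : walsh u i * walsh v i = walsh (symmDiff u v) i := by
    have e1 : walsh u i = walsh (u \ v) i * walsh (u ∩ v) i := by
      simp only [walsh]
      rw [mul_comm, Finset.prod_inter_mul_prod_sdiff]
    have e2 : walsh v i = walsh (v \ u) i * walsh (u ∩ v) i := by
      simp only [walsh]
      rw [mul_comm, Finset.inter_comm, Finset.prod_inter_mul_prod_sdiff]
    have e3 : walsh (symmDiff u v) i = walsh (u \ v) i * walsh (v \ u) i := by
      simp only [walsh, symmDiff, Finset.sup_eq_union]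
      exact Finset.prod_union disjoint_sdiff_sdiff
    rw [e1, e2, e3, mul_mul_mul_comm, Int.units_mul_self, mul_one]
  simp only [walshVec, ← h]
  push_cast
  rfl

theorem walshCoeff_walshVec_of_ne {u v : Finset (Fin k)} (h : u ≠ v) :
    walshCoeff (walshVec v) u = 0 := by
  simp_rw [walshCoeff, walshVec_mul_walshVec]
  apply sum_walshVec_eq_zero
  rw [Finset.nonempty_iff_ne_empty]
  exact fun e => h (symmDiff_eq_bot.1 e)

theorem linearIndependent_walshVec :
    LinearIndependent ℝ (walshVec : Finset (Fin k) → (Fin k → ℤˣ) → ℝ) := by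
  rw [Fintype.linearIndependent_iff]
  intro g hg u
  have h := congrArg (walshCoeffₗ u) hg
  rw [map_sum, Finset.sum_eq_single u, map_smul, map_zero] at h
  · refine (smul_eq_zero.1 h).resolve_right ?_
    simp [walshCoeffₗ, walshCoeff, walshVec_mul_self]
  · intro v _ hv
    have hz : walshCoeffₗ u (walshVec v) = 0 := walshCoeff_walshVec_of_ne hv.symm
    rw [map_smul, hz, smul_zero]
  · simp

/-- The vectors whose Walsh–Fourier coefficients vanish on `B` are spanned by the characters
outside `B`. -/
theorem mem_span_walshVec_iff (B : Finset (Finset (Fin k))) (z : (Fin k → ℤˣ) → ℝ) :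
    z ∈ Submodule.span ℝ (walshVec '' {u | u ∉ B}) ↔ ∀ u ∈ B, walshCoeff z u = 0 := by
  constructor
  · intro hz u hu
    have hle : Submodule.span ℝ (walshVec '' {u | u ∉ B}) ≤ LinearMap.ker (walshCoeffₗ u) := by
      rw [Submodule.span_le]
      rintro _ ⟨v, hv, rfl⟩
      exact walshCoeff_walshVec_of_ne (by rintro rfl; exact hv hu)
    exact hle hz
  · intro h
    have hz : z = ((2 : ℝ) ^ k)⁻¹ • ∑ u, walshCoeff z u • walshVec u := by
      rw [sum_walshCoeff_smul, smul_smul, inv_mul_cancel₀ (by positivity), one_smul]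
    rw [hz]
    refine Submodule.smul_mem _ _ (Submodule.sum_mem _ fun u _ => ?_)
    by_cases hu : u ∈ B
    · rw [h u hu, zero_smul]
      exact Submodule.zero_mem _
    · exact Submodule.smul_mem _ _ (Submodule.subset_span ⟨u, hu, rfl⟩)

theorem finrank_span_walshVec (B : Finset (Finset (Fin k))) :
    (Module.finrank ℝ (Submodule.span ℝ
      (walshVec '' {u : Finset (Fin k) | u ∉ B})) : ℤ) = 2 ^ k - #B := by
  have h := finrank_span_eq_card
    (linearIndependent_walshVec.comp (Subtype.val : {u : Finset (Fin k) // u ∉ B} → _)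
      Subtype.val_injective)
  rw [Set.range_comp, Subtype.range_coe_subtype] at h
  rw [h, Fintype.card_subtype_compl, Fintype.card_coe, Fintype.card_finset, Fintype.card_fin,
    Nat.cast_sub]
  · simp
  · simpa using Finset.card_le_univ B

end Walsh

/-! ### The action of the group on the characters -/

section Action

variable {k : ℕ}

/-- The permutation `g` carries the character of `u` to that of `v`, up to sign. -/
def CarriesWalsh (g : Equiv.Perm (Fin k → ℤˣ)) (u v : Finset (Fin k)) : Prop :=
  ∃ e : ℤˣ, ∀ i, walsh u (g i) = e * walsh v i

theorem CarriesWalsh.mul {g h : Equiv.Perm (Fin k → ℤˣ)} {u v w : Finset (Fin k)}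
    (hg : CarriesWalsh g u v) (hh : CarriesWalsh h v w) : CarriesWalsh (g * h) u w := by
  obtain ⟨e, he⟩ := hg
  obtain ⟨f, hf⟩ := hh
  exact ⟨e * f, fun i => by rw [Equiv.Perm.mul_apply, he, hf, mul_assoc]⟩

theorem CarriesWalsh.inv {g : Equiv.Perm (Fin k → ℤˣ)} {u v : Finset (Fin k)}
    (hg : CarriesWalsh g u v) : CarriesWalsh g⁻¹ v u := by
  obtain ⟨e, he⟩ := hg
  refine ⟨e, fun i => ?_⟩
  have h := he (g⁻¹ i)
  rw [Equiv.Perm.inv_def, Equiv.apply_symm_apply] at h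
  rw [h, ← mul_assoc, Int.units_mul_self, one_mul, Equiv.Perm.inv_def]

theorem walshCoeff_perm {g : Equiv.Perm (Fin k → ℤˣ)} {u v : Finset (Fin k)}
    (h : CarriesWalsh g u v) (x : (Fin k → ℤˣ) → ℝ) :
    ∃ e : ℤˣ, walshCoeff (fun i => x (g⁻¹ i)) u = ((e : ℤ) : ℝ) * walshCoeff x v := by
  obtain ⟨e, he⟩ := h
  refine ⟨e, ?_⟩
  rw [walshCoeff, walshCoeff, ← Equiv.sum_comp g, Finset.mul_sum]
  refine Finset.sum_congr rfl fun i _ => ?_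
  simp only [walshVec, he, Equiv.Perm.inv_def, Equiv.symm_apply_apply]
  push_cast
  ring

/-- If j is in u, the other factors contribute #u - 1 copies of i_j and column j itself the last;
otherwise every factor contributes one. -/
theorem walsh_colOp (u : Finset (Fin k)) (j : Fin k) (i : Fin k → ℤˣ) :
    walsh u (colOp j i) = walsh (u.erase j) i * i j ^ #u := by
  have hval : ∀ l, colOp j i l = if l = j then i j else i l * i j := fun l => rfl
  have herase : ∏ l ∈ u.erase j, colOp j i l = walsh (u.erase j) i * i j ^ #(u.erase j) := by
    rw [walsh, ← Finset.prod_const, ← Finset.prod_mul_distrib]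
    refine Finset.prod_congr rfl fun l hl => ?_
    rw [hval, if_neg (Finset.ne_of_mem_erase hl)]
  by_cases hj : j ∈ u
  · rw [walsh, ← Finset.prod_erase_mul _ _ hj, herase, hval, if_pos rfl, mul_assoc, ← pow_succ,
      Finset.card_erase_add_one hj]
  · rw [walsh]
    rw [Finset.erase_eq_of_notMem hj] at herase ⊢
    exact herase

theorem carriesWalsh_colOp_of_even {u : Finset (Fin k)} (hu : Even #u) (j : Fin k) :
    CarriesWalsh (colOp j) u (u.erase j) := by
  refine ⟨1, fun i => ?_⟩
  obtain ⟨m, hm⟩ := hu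
  rw [walsh_colOp, hm, ← two_mul, pow_mul, pow_two, Int.units_mul_self, one_pow, one_mul,
    mul_one]

theorem carriesWalsh_colOp_of_odd {u : Finset (Fin k)} (hu : Odd #u) (j : Fin k) :
    CarriesWalsh (colOp j) u (insert j u) := by
  refine ⟨1, fun i => ?_⟩
  obtain ⟨m, hm⟩ := hu
  rw [walsh_colOp, hm, pow_succ, pow_mul, pow_two, Int.units_mul_self, one_pow, one_mul,
    one_mul, walsh, walsh, ← Finset.insert_erase (Finset.mem_insert_self j u),
    Finset.prod_insert (Finset.notMem_erase _ _), mul_comm, Finset.erase_insert_eq_erase]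

theorem card_colOp_class (u : Finset (Fin k)) (j : Fin k) :
    ∃ v, CarriesWalsh (colOp j) u v ∧ (#v + 1) / 2 = (#u + 1) / 2 := by
  rcases Nat.even_or_odd #u with hu | hu
  · refine ⟨_, carriesWalsh_colOp_of_even hu j, ?_⟩
    obtain ⟨m, hm⟩ := hu
    by_cases hj : j ∈ u
    · have := Finset.card_erase_add_one hj
      omega
    · rw [Finset.erase_eq_of_notMem hj]
  · refine ⟨_, carriesWalsh_colOp_of_odd hu j, ?_⟩
    obtain ⟨m, hm⟩ := hu
    by_cases hj : j ∈ u
    · rw [Finset.insert_eq_of_mem hj]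
    · rw [Finset.card_insert_of_notMem hj]
      omega

theorem perm_units_apply (h : Equiv.Perm ℤˣ) (a : ℤˣ) : h a = h 1 * a := by
  rcases Int.units_eq_one_or a with rfl | rfl
  · rw [mul_one]
  · have hne : h (-1) ≠ h 1 := fun e => by simpa using h.injective e
    rcases Int.units_eq_one_or (h 1) with h1 | h1 <;>
      rcases Int.units_eq_one_or (h (-1)) with h2 | h2 <;> simp_all

theorem carriesWalsh_of_mem_Giso {g : Equiv.Perm (Fin k → ℤˣ)} (hg : g ∈ Giso k ℤˣ)
    (u : Finset (Fin k)) : ∃ v, CarriesWalsh g u v ∧ #v = #u := by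
  obtain ⟨h, p, hp⟩ := hg
  refine ⟨u.map p⁻¹.toEmbedding, ⟨∏ j ∈ u, h j 1, fun i => ?_⟩, Finset.card_map _⟩
  rw [walsh, walsh, Finset.prod_map, ← Finset.prod_mul_distrib]
  refine Finset.prod_congr rfl fun j _ => ?_
  rw [hp, perm_units_apply]
  rfl

theorem carriesWalsh_of_mem_GOD {g : Equiv.Perm (Fin k → ℤˣ)} (hg : g ∈ GOD k) :
    ∀ u : Finset (Fin k), ∃ v, CarriesWalsh g u v ∧ (#v + 1) / 2 = (#u + 1) / 2 := by
  induction hg using Subgroup.closure_induction'' with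
  | mem g hg =>
    intro u
    rcases hg with ⟨j, rfl⟩ | hg
    · exact card_colOp_class u j
    · obtain ⟨v, hv, hc⟩ := carriesWalsh_of_mem_Giso hg u
      exact ⟨v, hv, by rw [hc]⟩
  | inv_mem g hg =>
    intro u
    rcases hg with ⟨j, rfl⟩ | hg
    -- `colOp j` is an involution, hence definitionally its own inverse.
    · exact card_colOp_class u j
    · obtain ⟨v, hv, hc⟩ := carriesWalsh_of_mem_Giso (inv_mem hg) u
      exact ⟨v, hv, by rw [hc]⟩
  | one => exact fun u => ⟨u, ⟨1, fun i => by simp⟩, rfl⟩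
  | mul g h _ _ ihg ihh =>
    intro u
    obtain ⟨v, hv, hvc⟩ := ihg u
    obtain ⟨w, hw, hwc⟩ := ihh v
    exact ⟨w, hv.mul hw, hwc.trans hvc⟩

theorem colOp_mem_GOD (j : Fin k) : colOp j ∈ GOD k :=
  Subgroup.subset_closure (Or.inl ⟨j, rfl⟩)

theorem Giso_le_GOD : Giso k ℤˣ ≤ GOD k := fun _ hg => Subgroup.subset_closure (Or.inr hg)

theorem exists_carriesWalsh_of_card_eq {u v : Finset (Fin k)} (h : #u = #v) :
    ∃ g ∈ GOD k, CarriesWalsh g u v := by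
  let p : Equiv.Perm (Fin k) := (Finset.equivOfCardEq h).extendSubtype
  have hpmem : ∀ j ∈ u, p j ∈ v := fun j hj =>
    Equiv.extendSubtype_mem (Finset.equivOfCardEq h) j hj
  have hmap : u.map p.toEmbedding = v := by
    refine Finset.eq_of_subset_of_card_le ?_ (by rw [Finset.card_map, h])
    intro l hl
    obtain ⟨j, hj, rfl⟩ := Finset.mem_map.1 hl
    exact hpmem j hj
  refine ⟨Equiv.arrowCongr p⁻¹ (Equiv.refl ℤˣ), Giso_le_GOD ⟨fun _ => 1, p⁻¹, fun i j => ?_⟩,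
    1, fun i => ?_⟩
  · rfl
  · rw [one_mul, ← hmap, walsh, walsh, Finset.prod_map]
    rfl

/-- Each class is normalised to its odd size 2m-1, so that coordinate permutations can then connect
any two members. -/
theorem exists_carriesWalsh_odd (u : Finset (Fin k)) (hu : u.Nonempty) :
    ∃ g ∈ GOD k, ∃ v, CarriesWalsh g u v ∧ #v + 1 = 2 * ((#u + 1) / 2) := by
  rcases Nat.even_or_odd #u with h | h
  · obtain ⟨j, hj⟩ := hu
    refine ⟨colOp j, colOp_mem_GOD j, _, carriesWalsh_colOp_of_even h j, ?_⟩
    rw [Finset.card_erase_add_one hj]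
    obtain ⟨m, hm⟩ := h
    omega
  · refine ⟨1, one_mem _, u, ⟨1, fun i => by simp⟩, ?_⟩
    obtain ⟨m, hm⟩ := h
    omega

/-- The group is transitive, up to sign, on the characters of the sizes `2 m - 1` and `2 m`. -/
theorem exists_carriesWalsh {u v : Finset (Fin k)} (hu : u.Nonempty)
    (h : (#u + 1) / 2 = (#v + 1) / 2) : ∃ g ∈ GOD k, CarriesWalsh g u v := by
  have hv : v.Nonempty := by
    rw [← Finset.card_pos] at hu ⊢
    omega
  obtain ⟨g, hg, u', hu', hcu⟩ := exists_carriesWalsh_odd u hu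
  obtain ⟨f, hf, v', hv', hcv⟩ := exists_carriesWalsh_odd v hv
  obtain ⟨p, hp, hp'⟩ := exists_carriesWalsh_of_card_eq (u := u') (v := v') (by omega)
  exact ⟨g * p * f⁻¹, mul_mem (mul_mem hg hp) (inv_mem hf), (hu'.mul hp').mul hv'.inv⟩

theorem mulLeft_mem_GOD (a : Fin k → ℤˣ) : Equiv.mulLeft a ∈ GOD k :=
  Giso_le_GOD ⟨fun j => Equiv.mulLeft (a j), 1, fun i j => by simp⟩

end Action

/-! ### The affine hull of an orbit -/

section AffineHull

variable {k : ℕ}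

theorem self_mem_vecOrbit (x : (Fin k → ℤˣ) → ℝ) : x ∈ vecOrbit (GOD k) x :=
  ⟨1, one_mem _, by simp⟩

theorem comp_inv_mem_vecOrbit {g : Equiv.Perm (Fin k → ℤˣ)} (hg : g ∈ GOD k)
    {x y : (Fin k → ℤˣ) → ℝ} (hy : y ∈ vecOrbit (GOD k) x) :
    (fun i => y (g⁻¹ i)) ∈ vecOrbit (GOD k) x := by
  obtain ⟨f, hf, rfl⟩ := hy
  exact ⟨g * f, mul_mem hg hf, by simp [mul_inv_rev]⟩

/-- Summing the translates of y against the character of u leaves only its u-component. Subtracting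
y puts each term in the vector span and changes nothing, since a nontrivial character sums to zero.
-/
theorem walshVec_mem_of_walshCoeff_ne_zero {x y : (Fin k → ℤˣ) → ℝ}
    (hy : y ∈ vecOrbit (GOD k) x) {u : Finset (Fin k)} (hu : u.Nonempty)
    (h : walshCoeff y u ≠ 0) : walshVec u ∈ vectorSpan ℝ (vecOrbit (GOD k) x) := by
  have hmem : ∀ a : Fin k → ℤˣ,
      (fun i => y ((Equiv.mulLeft a)⁻¹ i)) - y ∈ vectorSpan ℝ (vecOrbit (GOD k) x) := fun a =>
    vsub_mem_vectorSpan ℝ (comp_inv_mem_vecOrbit (mulLeft_mem_GOD a) hy) hy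
  have hsum : ∑ a, walshVec u a • ((fun i => y ((Equiv.mulLeft a)⁻¹ i)) - y) =
      walshCoeff y u • walshVec u := by
    funext i
    simp only [Finset.sum_apply, Pi.smul_apply, Pi.sub_apply, smul_eq_mul, mul_sub,
      Finset.sum_sub_distrib]
    rw [← Finset.sum_mul, sum_walshVec_eq_zero hu, zero_mul, sub_zero, walshCoeff, Finset.sum_mul,
      ← Equiv.sum_comp (Equiv.mulRight i)]
    refine Finset.sum_congr rfl fun a _ => ?_
    have ha : a * a = 1 := by
      funext j
      exact Int.units_mul_self (a j)
    have : ((Equiv.mulLeft ((Equiv.mulRight i) a))⁻¹ : Equiv.Perm (Fin k → ℤˣ)) i = a := by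
      rw [Equiv.Perm.inv_eq_iff_eq]
      change i = a * i * a
      rw [mul_right_comm, ha, one_mul]
    rw [this, Equiv.coe_mulRight, walshVec_mul]
    ring
  have := Submodule.smul_mem _ (walshCoeff y u)⁻¹
    (Submodule.sum_mem _ fun a _ => Submodule.smul_mem _ (walshVec u a) (hmem a) :
      ∑ a ∈ Finset.univ, walshVec u a • ((fun i => y ((Equiv.mulLeft a)⁻¹ i)) - y) ∈
        vectorSpan ℝ (vecOrbit (GOD k) x))
  rwa [hsum, smul_smul, inv_mul_cancel₀ h, one_smul] at this

theorem vectorSpan_vecOrbit (x : (Fin k → ℤˣ) → ℝ) (B : Finset (Finset (Fin k)))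
    (hB : ∀ u, u ∈ B ↔
      (u = ∅ ∨ ∀ v : Finset (Fin k), (#v + 1) / 2 = (#u + 1) / 2 → walshCoeff x v = 0)) :
    vectorSpan ℝ (vecOrbit (GOD k) x) = Submodule.span ℝ (walshVec '' {u | u ∉ B}) := by
  apply le_antisymm
  · rw [vectorSpan_eq_span_vsub_set_right ℝ (self_mem_vecOrbit x), Submodule.span_le]
    rintro _ ⟨_, ⟨g, hg, rfl⟩, rfl⟩
    simp only [SetLike.mem_coe, vsub_eq_sub]
    rw [mem_span_walshVec_iff]
    intro u hu
    rw [walshCoeff_sub, sub_eq_zero]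
    rcases (hB u).1 hu with rfl | h
    · simp only [walshCoeff, walshVec, walsh, Finset.prod_empty]
      simpa using Equiv.sum_comp g⁻¹ x
    · obtain ⟨v, hv, hc⟩ := carriesWalsh_of_mem_GOD hg u
      obtain ⟨e, he⟩ := walshCoeff_perm hv x
      rw [he, h v hc, h u rfl, mul_zero]
  · rw [Submodule.span_le]
    rintro _ ⟨u, hu, rfl⟩
    rw [Set.mem_ofPred_eq, hB] at hu
    push Not at hu
    obtain ⟨hne, v, hvc, hv⟩ := hu
    obtain ⟨g, hg, hc⟩ := exists_carriesWalsh hne hvc.symm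
    obtain ⟨e, he⟩ := walshCoeff_perm hc x
    refine walshVec_mem_of_walshCoeff_ne_zero
      (comp_inv_mem_vecOrbit hg (self_mem_vecOrbit x)) hne ?_
    rw [he]
    refine mul_ne_zero ?_ hv
    exact_mod_cast e.ne_zero

end AffineHull

/-! ### Divisibility of the coefficients -/

section Divisibility

variable {k : ℕ}

/-- This and `sum_walsh_mul_eq` are mutually inverse changes of basis between products of i_j and
products of 1 - i_j; the latter are highly divisible by 2. -/
theorem sum_prod_one_sub (x : (Fin k → ℤˣ) → ℤ) (w : Finset (Fin k)) :
    ∑ i, (∏ j ∈ w, (1 - (i j : ℤ))) * x i =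
      ∑ v ∈ w.powerset, (-1) ^ #v * ∑ i, (walsh v i : ℤ) * x i := by
  simp_rw [Finset.mul_sum]
  rw [Finset.sum_comm]
  refine Finset.sum_congr rfl fun i _ => ?_
  simp_rw [sub_eq_add_neg, Finset.prod_one_add, Finset.sum_mul]
  refine Finset.sum_congr rfl fun v _ => ?_
  rw [Finset.prod_neg, walsh, Units.coe_prod, mul_assoc]

theorem sum_walsh_mul_eq (x : (Fin k → ℤˣ) → ℤ) (u : Finset (Fin k)) :
    ∑ i, (walsh u i : ℤ) * x i =
      ∑ w ∈ u.powerset, (-1) ^ #w * ∑ i, (∏ j ∈ w, (1 - (i j : ℤ))) * x i := by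
  simp_rw [Finset.mul_sum]
  rw [Finset.sum_comm]
  refine Finset.sum_congr rfl fun i _ => ?_
  simp_rw [← mul_assoc, ← Finset.prod_neg]
  rw [← Finset.sum_mul, ← Finset.prod_one_add]
  simp [walsh, Units.coe_prod]

theorem two_pow_dvd_prod_one_sub (w : Finset (Fin k)) (i : Fin k → ℤˣ) :
    (2 : ℤ) ^ #w ∣ ∏ j ∈ w, (1 - (i j : ℤ)) := by
  rw [← Finset.prod_const]
  refine Finset.prod_dvd_prod_of_dvd _ _ fun j _ => ?_
  rcases Int.units_eq_one_or (i j) with h | h <;> simp [h]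

/-- The coefficients of an integral vector of strength `s` and total `N`, modulo `2 ^ (s + 1)`. -/
theorem sum_walsh_modEq (x : (Fin k → ℤˣ) → ℤ) (s : ℕ) (N : ℤ) (h0 : ∑ i, x i = N)
    (hs : ∀ v : Finset (Fin k), 1 ≤ #v → #v ≤ s → ∑ i, (walsh v i : ℤ) * x i = 0)
    (u : Finset (Fin k)) {l : ℕ} (hu : #u = l + 1) :
    ∑ i, (walsh u i : ℤ) * x i ≡ N * ((-1) ^ s * l.choose s) [ZMOD 2 ^ (s + 1)] := by
  have hsmall : ∀ w : Finset (Fin k), #w ≤ s →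
      ∑ i, (∏ j ∈ w, (1 - (i j : ℤ))) * x i = N := by
    intro w hw
    rw [sum_prod_one_sub, Finset.sum_eq_single ∅]
    · simp [walsh, h0]
    · intro v hv hne
      rw [hs v (Finset.card_pos.2 (Finset.nonempty_iff_ne_empty.2 hne))
        ((Finset.card_le_card (Finset.mem_powerset.1 hv)).trans hw), mul_zero]
    · simp
  have hlarge : ∀ w : Finset (Fin k), s < #w →
      (2 : ℤ) ^ (s + 1) ∣ ∑ i, (∏ j ∈ w, (1 - (i j : ℤ))) * x i := fun w hw =>
    Finset.dvd_sum fun i _ => Dvd.dvd.mul_right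
      ((pow_dvd_pow 2 hw).trans (two_pow_dvd_prod_one_sub w i)) _
  -- Only w of size at most s survive the modulus, leaving the truncated alternating sum of
  -- C(l+1,m), which equals (-1)^s C(l,s).
  have hmain : ∑ w ∈ u.powerset, (if #w ≤ s then (-1 : ℤ) ^ #w * N else 0) =
      N * ((-1) ^ s * l.choose s) := by
    rw [Finset.sum_powerset_apply_card (fun m => if m ≤ s then (-1 : ℤ) ^ m * N else 0), hu,
      ← Int.alternating_sum_range_choose_eq_choose, Finset.mul_sum]
    simp only [nsmul_eq_mul, mul_ite, mul_zero]
    rw [← Finset.sum_filter]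
    refine Finset.sum_subset_zero_on_sdiff ?_ ?_ ?_
    · intro m hm
      rw [Finset.mem_range]
      exact Nat.lt_succ_of_le (Finset.mem_filter.1 hm).2
    · intro m hm
      simp only [Finset.mem_sdiff, Finset.mem_range, Finset.mem_filter, not_and] at hm
      rw [Nat.choose_eq_zero_of_lt (by omega)]
      simp
    · intro m _
      ring
  rw [sum_walsh_mul_eq, ← hmain]
  refine Int.ModEq.sum fun w _ => ?_
  split_ifs with hw
  · rw [hsmall w hw]
  · exact (Int.modEq_zero_iff_dvd.2 (Dvd.dvd.mul_left (hlarge w (not_le.1 hw)) _))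

end Divisibility

theorem even_of_walshCoeff_eq_zero {k s lam : ℕ} {pmax : ℤ} {x : (Fin k → ℤˣ) → ℝ}
    (hx : ILDFeasible s lam pmax x) {d : ℕ} {u : Finset (Fin k)} (hu : #u = s + d + 1)
    (h : walshCoeff x u = 0) : lam * (s + d).choose d ≡ 0 [MOD 2] := by
  obtain ⟨hE, hI⟩ := hx
  rw [ildEqualities_iff] at hE
  choose _ _ m hm using hI
  have hcoeff : ∀ v, walshCoeff x v = ((∑ i, (walsh v i : ℤ) * m i : ℤ) : ℝ) := by
    intro v
    simp [walshCoeff, walshVec, hm]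
  have h0 : ∑ i, m i = (lam : ℤ) * 2 ^ s := by
    have := hE.1
    rw [hcoeff] at this
    simp only [walsh, Finset.prod_empty, Units.val_one, one_mul] at this
    exact_mod_cast this
  have hs : ∀ v : Finset (Fin k), 1 ≤ #v → #v ≤ s → ∑ i, (walsh v i : ℤ) * m i = 0 := by
    intro v h1 h2
    have := hE.2 v h1 h2
    rw [hcoeff] at this
    exact_mod_cast this
  have hmod := sum_walsh_modEq m s _ h0 hs u hu
  have hz : ∑ i, (walsh u i : ℤ) * m i = 0 := by
    rw [hcoeff] at h
    exact_mod_cast h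
  rw [hz] at hmod
  -- The total λ 2^s cancels 2^s from the modulus, so a parity condition remains.
  have hd : (2 : ℤ) ^ s * 2 ∣ 2 ^ s * ((-1) ^ s * (lam * (s + d).choose s)) := by
    rw [← pow_succ]
    convert Int.modEq_zero_iff_dvd.1 hmod.symm using 1
    ring
  have hd2 := Int.dvd_of_mul_dvd_mul_left (by positivity) hd
  rw [Nat.modEq_zero_iff_dvd, Nat.choose_symm_add.symm]
  rcases neg_one_pow_eq_or ℤ s with e | e <;> rw [e] at hd2
  · rw [one_mul] at hd2
    exact_mod_cast hd2
  · rw [neg_one_mul, dvd_neg] at hd2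
    exact_mod_cast hd2

/-- The subsets on which the coefficients are prescribed, counted by size. -/
theorem card_filter_card_le_or (k s : ℕ) (T : Finset ℕ) (hT : ∀ d ∈ T, Even d) :
    (#{u : Finset (Fin k) | #u ≤ s ∨ ∃ d ∈ T, s + d + 1 ≤ #u ∧ #u ≤ s + d + 2} : ℤ) =
      ∑ j ∈ Finset.range (s + 1), (k.choose j : ℤ) +
        ∑ d ∈ T, ((k.choose (s + d + 1) : ℤ) + (k.choose (s + d + 2) : ℤ)) := by
  have hcard : ∀ S : Finset ℕ,
      (#{u : Finset (Fin k) | #u ∈ S} : ℤ) = ∑ j ∈ S, (k.choose j : ℤ) := by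
    intro S
    rw [Finset.card_eq_sum_card_fiberwise (f := Finset.card) (t := S) (fun u hu => by simpa using hu)]
    push_cast
    refine Finset.sum_congr rfl fun j hj => ?_
    have h := Finset.card_powersetCard j (Finset.univ : Finset (Fin k))
    rw [Finset.card_univ, Fintype.card_fin] at h
    rw [← h]
    congr 2
    ext u
    simp only [Finset.mem_filter, Finset.mem_univ, true_and, Finset.mem_powersetCard,
      Finset.subset_univ]
    exact ⟨fun h => h.2, fun h => ⟨h ▸ hj, h⟩⟩
  have hset : Finset.univ.filter (fun u : Finset (Fin k) =>
      #u ≤ s ∨ ∃ d ∈ T, s + d + 1 ≤ #u ∧ #u ≤ s + d + 2) =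
      Finset.univ.filter (fun u : Finset (Fin k) =>
        #u ∈ Finset.range (s + 1) ∪ T.biUnion fun d => {s + d + 1, s + d + 2}) := by
    refine Finset.filter_congr fun u _ => ?_
    simp only [Finset.mem_union, Finset.mem_range, Finset.mem_biUnion, Finset.mem_insert,
      Finset.mem_singleton]
    exact or_congr (by omega) (exists_congr fun d => and_congr_right fun _ => by omega)
  rw [hset, hcard, Finset.sum_union, Finset.sum_biUnion]
  · congr 1
    exact Finset.sum_congr rfl fun d _ => Finset.sum_pair (by omega)
  -- Distinct even d differ by at least 2, so their pairs of sizes are disjoint.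
  · intro d hd e he hde
    obtain ⟨a, ha⟩ := hT d hd
    obtain ⟨b, hb⟩ := hT e he
    simp only [Function.onFun, Finset.disjoint_left, Finset.mem_insert, Finset.mem_singleton]
    omega
  · simp only [Finset.disjoint_left, Finset.mem_range, Finset.mem_biUnion, Finset.mem_insert,
      Finset.mem_singleton]
    rintro a ha ⟨d, _, hd⟩
    omega

/-! ### Assembly: the vanishing classes determine T -/

theorem mainTheorem4 (k s lam : ℕ) (pmax : ℤ) (hk : 1 ≤ k) (hsk : s ≤ k) (hs : Even s)
    (hlam : 1 ≤ lam) (x : (Fin k → ℤˣ) → ℝ) (hx : ILDFeasible s lam pmax x) :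
    ∃ T ⊆ Omega k s lam,
      ((setDim (convexHull ℝ (vecOrbit (GOD k) x)) : ℤ) =
        2 ^ k - ∑ j ∈ Finset.range (s + 1), (k.choose j : ℤ) -
          ∑ d ∈ T, ((k.choose (s + d + 1) : ℤ) + (k.choose (s + d + 2) : ℤ))) ∧
      affineSpan ℝ (convexHull ℝ (vecOrbit (GOD k) x)) = affineSpan ℝ (vecOrbit (GOD k) x) ∧
      (affineSpan ℝ (convexHull ℝ (vecOrbit (GOD k) x)) : Set ((Fin k → ℤˣ) → ℝ)) =
        {z | ILDEqualities s lam z ∧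
          ∀ d ∈ T, ∀ u : Finset (Fin k), s + d + 1 ≤ u.card → u.card ≤ s + d + 2 →
            ∀ i, jChar z u i = 0} := by
  classical
  have hE := (ildEqualities_iff s lam x).1 hx.1
  let T : Finset ℕ := {d ∈ Finset.range (k - s) | Even d ∧
    ∀ u : Finset (Fin k), s + d + 1 ≤ #u → #u ≤ s + d + 2 → walshCoeff x u = 0}
  have hT : ∀ d, d ∈ T ↔ d < k - s ∧ Even d ∧
      ∀ u : Finset (Fin k), s + d + 1 ≤ #u → #u ≤ s + d + 2 → walshCoeff x u = 0 := by
    intro d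
    simp [T]
  let B : Finset (Finset (Fin k)) :=
    {u | #u ≤ s ∨ ∃ d ∈ T, s + d + 1 ≤ #u ∧ #u ≤ s + d + 2}
  have hBmem : ∀ u, u ∈ B ↔ #u ≤ s ∨ ∃ d ∈ T, s + d + 1 ≤ #u ∧ #u ≤ s + d + 2 := by
    intro u
    simp [B]
  -- Evenness of s and d aligns the sizes up to s and the pairs of T with the classes {2m-1, 2m}.
  have hB : ∀ u, u ∈ B ↔
      (u = ∅ ∨ ∀ v : Finset (Fin k), (#v + 1) / 2 = (#u + 1) / 2 → walshCoeff x v = 0) := by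
    intro u
    rw [hBmem]
    obtain ⟨a, ha⟩ := hs
    constructor
    · rintro (h | ⟨d, hd, h1, h2⟩)
      · rcases u.eq_empty_or_nonempty with rfl | hne
        · exact Or.inl rfl
        · have := Finset.card_pos.2 hne
          exact Or.inr fun v hv => hE.2 v (by omega) (by omega)
      · obtain ⟨_, ⟨b, hb⟩, h⟩ := (hT d).1 hd
        exact Or.inr fun v hv => h v (by omega) (by omega)
    · rintro (rfl | h)
      · simp
      · rw [or_iff_not_imp_left]
        intro hus
        have huk : #u ≤ k := by simpa using Finset.card_le_univ u
        -- With m = (#u+1)/2, this d solves s + d + 1 = 2m - 1.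
        refine ⟨2 * ((#u + 1) / 2) - 2 - s, (hT _).2 ⟨by omega, ?_, fun v h1 h2 => h v (by omega)⟩,
          by omega, by omega⟩
        exact ⟨(#u + 1) / 2 - 1 - a, by omega⟩
  have hspan := vectorSpan_vecOrbit x B hB
  refine ⟨T, ?_, ?_, affineSpan_convexHull _, ?_⟩
  · intro d hd
    obtain ⟨h1, h2, h3⟩ := (hT d).1 hd
    obtain ⟨u, -, hu⟩ := Finset.exists_subset_card_eq
      (s := (Finset.univ : Finset (Fin k))) (n := s + d + 1) (by simp; omega)
    simp only [Omega, Finset.mem_filter, Finset.mem_range]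
    exact ⟨h1, h2, even_of_walshCoeff_eq_zero hx hu (h3 u (by omega) (by omega))⟩
  · rw [setDim, affineSpan_convexHull, direction_affineSpan, hspan, finrank_span_walshVec,
      card_filter_card_le_or k s T fun d hd => ((hT d).1 hd).2.1]
    ring
  · rw [affineSpan_convexHull]
    ext z
    have hxmem := subset_affineSpan ℝ _ (self_mem_vecOrbit x)
    -- A point z lies in the hull exactly when z and x have the same coefficients on `B`.
    rw [SetLike.mem_coe, ← AffineSubspace.vsub_right_mem_direction_iff_mem hxmem,
      direction_affineSpan, hspan, vsub_eq_sub, mem_span_walshVec_iff, Set.mem_ofPred_eq,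
      ildEqualities_iff]
    simp only [walshCoeff_sub, sub_eq_zero, forall_jChar_eq_zero_iff]
    have hBx : ∀ u ∈ B, u.Nonempty → walshCoeff x u = 0 := fun u hu hne =>
      ((hB u).1 hu).resolve_left hne.ne_empty u rfl
    constructor
    · intro h
      refine ⟨⟨(h ∅ ((hB _).2 (Or.inl rfl))).trans hE.1, fun u h1 h2 => ?_⟩,
        fun d hd u h1 h2 => ?_⟩
      · rw [h u ((hBmem u).2 (Or.inl h2)), hE.2 u h1 h2]
      · rw [h u ((hBmem u).2 (Or.inr ⟨d, hd, h1, h2⟩)), ((hT d).1 hd).2.2 u h1 h2]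
    · rintro ⟨⟨h0, h1⟩, h2⟩ u hu
      rcases u.eq_empty_or_nonempty with rfl | hne
      · rw [h0, hE.1]
      · rw [hBx u hu hne]
        rcases (hBmem u).1 hu with h | ⟨d, hd, h3, h4⟩
        · exact h1 u (Finset.card_pos.2 hne) h
        · exact h2 d hd u h3 h4
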